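/- For a finite graph $G$ and $b\ge 1$ let $\chi_b(G)$ be the least $m$ for which one can assign to every vertex a $b$-element subset of $\{1,\dots,m\}$ so that adjacent vertices receive disjoint subsets, and let $\chi_f(G)=\inf_{b\ge 1}\chi_b(G)/b$ be the fractional chromatic number of $G$. A graph is $4$-edge-critical if its chromatic number is $4$ and the removal of any edge decreases the chromatic number. The crowning of a graph $G$ at a triangle $t_0t_1t_2$ (indices modulo $3$) is the graph obtained from $G$ by replacing each edge $t_it_{i+1}$ by a path $t_i\,x_i\,y_i\,t_{i+1}$ with two new vertices $x_i,y_i$, adding the edges $y_ix_{i+1}$, and adding a triangle $z_0z_1z_2$ on three further new vertices, together with the edges $z_ix_i$ and $z_iy_i$ (for $i=0,1,2$). Theorem. There is an infinite sequence $G_0,G_1,G_2,\dots$ of $4$-edge-critical $4$-regular planar graphs with $\chi_f(G_k)=3$ for all $k$, such that $G_0$ has $18$ vertices and, for every $k$, $G_{k+1}$ is (isomorphic to) the crowning of $G_k$ at a triangle that bounds a face in some plane drawing of $G_k$; in particular $G_k$ has $18+9k$ vertices, so the graphs are pairwise non-isomorphic. Consequently it is not true that every finite planar graph with chromatic number $4$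 has fractional chromatic number strictly greater than $3$ (a conjecture of Gimbel, Kündgen, Li and Thomassen). -/

import Mathlib

noncomputable section

/-- A drawing of a graph in the plane without crossings: distinct vertices are distinct points,
every edge is a simple arc between its two ends that contains no other vertex, and two
different edges meet at most in points that represent a vertex. (`arc` is only relevant on the
edges of `G`.) -/
structure PlaneDrawing {V : Type*} (G : SimpleGraph V) where
  point : V → ℝ × ℝ
  arc : Sym2 V → Set (ℝ × ℝ)
  point_injective : Function.Injective point
  arc_simple : ∀ u v, G.Adj u v →
    ∃ γ : Path (point u) (point v), Function.Injective γ ∧ Set.range γ = arc s(u, v)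
  mem_of_point_mem_arc : ∀ e ∈ G.edgeSet, ∀ v, point v ∈ arc e → v ∈ e
  arc_inter_arc : ∀ e ∈ G.edgeSet, ∀ f ∈ G.edgeSet, e ≠ f → arc e ∩ arc f ⊆ Set.range point

namespace PlaneDrawing

variable {V : Type*} {G : SimpleGraph V}

/-- The set of all points of the plane that belong to the drawn graph. -/
def carrier (D : PlaneDrawing G) : Set (ℝ × ℝ) :=
  Set.range D.point ∪ ⋃ e ∈ G.edgeSet, D.arc e

/-- The faces: the connected components of the complement of the drawn graph. -/
def IsFace (D : PlaneDrawing G) (F : Set (ℝ × ℝ)) : Prop :=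
  ∃ x ∈ D.carrierᶜ, F = connectedComponentIn D.carrierᶜ x

/-- `t 0, t 1, t 2` is a triangle of `G` that bounds a face of the drawing. -/
def IsFacialTriangle (D : PlaneDrawing G) (t : Fin 3 → V) : Prop :=
  (∀ i, G.Adj (t i) (t (i + 1))) ∧
    ∃ F, D.IsFace F ∧ frontier F = ⋃ i, D.arc s(t i, t (i + 1))

end PlaneDrawing

namespace SimpleGraph

variable {V : Type*}

/-- A graph is planar if it can be drawn in the plane without crossings. -/
def IsPlanar (G : SimpleGraph V) : Prop := Nonempty (PlaneDrawing G)

/-- `G` is `k`-chromatic and the removal of any edge decreases the chromatic number. -/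
def IsEdgeCritical (G : SimpleGraph V) (k : ℕ) : Prop :=
  G.chromaticNumber = k ∧
    ∀ e ∈ G.edgeSet, (G.deleteEdges {e}).chromaticNumber < G.chromaticNumber

/-- `c` assigns to every vertex a set of `b` out of `m` colors such that adjacent vertices get
disjoint sets. -/
def IsFoldColoring (G : SimpleGraph V) (b m : ℕ) (c : V → Finset (Fin m)) : Prop :=
  (∀ v, (c v).card = b) ∧ ∀ u v, G.Adj u v → Disjoint (c u) (c v)

/-- The `b`-chromatic number of a finite graph: the least number of colors in a `b`-fold
coloring. -/
def foldChromaticNumber (G : SimpleGraph V) (b : ℕ) : ℕ :=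
  sInf {m : ℕ | ∃ c : V → Finset (Fin m), G.IsFoldColoring b m c}

/-- The fractional chromatic number of a finite graph, `inf_{b ≥ 1} χ_b(G) / b`. -/
def fractionalChromaticNumber (G : SimpleGraph V) : ℝ :=
  ⨅ b : ℕ+, (G.foldChromaticNumber b : ℝ) / (b : ℝ)

/-- The vertices of the crowning at a triangle: the old vertices and nine new ones
`x 0, x 1, x 2`, `y 0, y 1, y 2`, `z 0, z 1, z 2`, in this order. -/
abbrev CrownVertex (V : Type*) : Type _ := V ⊕ Fin 3 ⊕ Fin 3 ⊕ Fin 3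

/-- One orientation of each edge of the crowning at the triangle `t 0, t 1, t 2`. Each side
`t i, t (i + 1)` is replaced by a path `t i, x i, y i, t (i + 1)`; at every corner `t (i + 1)` its
two new neighbors `y i` and `x (i + 1)` are joined, which closes a hexagon of the `x i, y i`; and
a triangle `z 0, z 1, z 2` is put inside the hexagon, with `z i` joined to `x i` and `y i`. -/
def crownRel (G : SimpleGraph V) (t : Fin 3 → V) : CrownVertex V → CrownVertex V → Prop
  | .inl u, .inl v => G.Adj u v ∧ ¬ ((∃ i, u = t i) ∧ ∃ j, v = t j)
  | .inl u, .inr (.inl i) => u = t i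
  | .inl u, .inr (.inr (.inl i)) => u = t (i + 1)
  | .inr (.inl i), .inr (.inr (.inl j)) => i = j ∨ i = j + 1
  | .inr (.inr (.inr i)), .inr (.inl j) => i = j
  | .inr (.inr (.inr i)), .inr (.inr (.inl j)) => i = j
  | .inr (.inr (.inr i)), .inr (.inr (.inr j)) => i ≠ j
  | _, _ => False

/-- The graph obtained from `G` by crowning the triangle `t 0, t 1, t 2`. -/
def crown (G : SimpleGraph V) (t : Fin 3 → V) : SimpleGraph (CrownVertex V) :=
  SimpleGraph.fromRel (G.crownRel t)

end SimpleGraph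

end

/-! All required properties are packed into one invariant of a graph with a chosen triangle,
`CrownSeed`: 4-regularity, no 3-coloring, a 3-coloring after deletion of any edge, a 2-fold coloring
with 6 colors, and a drawing in which the triangle is empty. It holds for an explicit graph on 18
vertices by finite computation, and `CrownSeed.crown` passes it on to the crowning, with the new
triangle of the z i as the next chosen triangle.

Three facts about the gadget (the crowning of a bare triangle) carry the induction. Every 3-coloring
of it gives the three corners different colors, so it enforces what the deleted triangle edges
enforced (`Colorable.of_crown`). Without any one of its edges, it has a 3-coloring in which exactly
two corners agree, with any prescribed pair; this fits a 3-coloring of G minus a triangle edge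
(`crown_deleteEdges_colorable`). Finally, the crowning maps homomorphically onto G
(`adj_crownFold`), so fold colorings pull back with the same parameters.

The 2-fold coloring gives fractional chromatic number at most 6/2, and a triangle forces at least 3.
Planarity needs no general topology: drawings are straight-line, the gadget fits into the empty
triangle, and that triangle is visibly a face because it is convex. -/

noncomputable section

/-! ### Straight-line drawings with a distinguished triangular face -/

/-- The corners of a reference triangle with centroid `0`. -/
def trianglePt : Fin 3 → ℝ × ℝ := ![(1, 0), (0, 1), (-1, -1)]

/-- The closed triangle with the corners `M • trianglePt i`. -/
def closedTriangle (M : ℝ) : Set (ℝ × ℝ) :=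
  {q | 0 ≤ M + 2 * q.1 - q.2 ∧ 0 ≤ M - q.1 + 2 * q.2 ∧ 0 ≤ M - q.1 - q.2}

/-- The open triangle with the corners `M • trianglePt i`. -/
def openTriangle (M : ℝ) : Set (ℝ × ℝ) :=
  {q | 0 < M + 2 * q.1 - q.2 ∧ 0 < M - q.1 + 2 * q.2 ∧ 0 < M - q.1 - q.2}

theorem smul_mem_closedTriangle {M c : ℝ} (hc : 0 < c) {q : ℝ × ℝ} :
    c • q ∈ closedTriangle (c * M) ↔ q ∈ closedTriangle M := by
  have h : ∀ x : ℝ, 0 ≤ c * x ↔ 0 ≤ x := fun x => mul_nonneg_iff_of_pos_left hc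
  simp only [closedTriangle, Set.mem_ofPred_eq, Prod.smul_fst, Prod.smul_snd, smul_eq_mul]
  rw [← h (M + 2 * q.1 - q.2), ← h (M - q.1 + 2 * q.2), ← h (M - q.1 - q.2)]
  ring_nf

theorem convex_closedTriangle (M : ℝ) : Convex ℝ (closedTriangle M) := by
  rintro p ⟨h1, h2, h3⟩ q ⟨k1, k2, k3⟩ a b ha hb hab
  simp only [closedTriangle, Set.mem_ofPred_eq, Prod.fst_add, Prod.snd_add, Prod.smul_fst,
    Prod.smul_snd, smul_eq_mul]
  have hM : M = a * M + b * M := by rw [← add_mul, hab, one_mul]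
  refine ⟨?_, ?_, ?_⟩
  · nlinarith [mul_nonneg ha h1, mul_nonneg hb k1]
  · nlinarith [mul_nonneg ha h2, mul_nonneg hb k2]
  · nlinarith [mul_nonneg ha h3, mul_nonneg hb k3]

theorem convex_openTriangle (M : ℝ) : Convex ℝ (openTriangle M) := by
  refine convex_iff_forall_pos.2 ?_
  rintro p ⟨h1, h2, h3⟩ q ⟨k1, k2, k3⟩ a b ha hb hab
  simp only [openTriangle, Set.mem_ofPred_eq, Prod.fst_add, Prod.snd_add, Prod.smul_fst,
    Prod.smul_snd, smul_eq_mul]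
  have hM : M = a * M + b * M := by rw [← add_mul, hab, one_mul]
  refine ⟨?_, ?_, ?_⟩
  · nlinarith [mul_pos ha h1, mul_pos hb k1]
  · nlinarith [mul_pos ha h2, mul_pos hb k2]
  · nlinarith [mul_pos ha h3, mul_pos hb k3]

theorem isOpen_openTriangle (M : ℝ) : IsOpen (openTriangle M) := by
  have h : ∀ f : ℝ × ℝ → ℝ, Continuous f → IsOpen {q | 0 < f q} :=
    fun f hf => isOpen_lt continuous_const hf
  exact (h _ (by fun_prop)).inter ((h _ (by fun_prop)).inter (h _ (by fun_prop)))

theorem isClosed_closedTriangle (M : ℝ) : IsClosed (closedTriangle M) := by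
  have h : ∀ f : ℝ × ℝ → ℝ, Continuous f → IsClosed {q | 0 ≤ f q} :=
    fun f hf => isClosed_le continuous_const hf
  exact (h _ (by fun_prop)).inter ((h _ (by fun_prop)).inter (h _ (by fun_prop)))

theorem closure_openTriangle {M : ℝ} (hM : 0 < M) :
    closure (openTriangle M) = closedTriangle M := by
  refine subset_antisymm (closure_minimal ?_ (isClosed_closedTriangle M)) ?_
  · rintro q ⟨h1, h2, h3⟩
    exact ⟨h1.le, h2.le, h3.le⟩
  · rintro q ⟨h1, h2, h3⟩
    -- The centroid 0 is interior, so shrinking towards it moves every point of the closed triangle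
    -- into the open one.
    have hlim : Filter.Tendsto (fun n : ℕ => (1 - 1 / ((n : ℝ) + 1)) • q) Filter.atTop
        (nhds q) := by
      have := (tendsto_one_div_add_atTop_nhds_zero_nat (𝕜 := ℝ)).const_sub 1
      simpa using this.smul_const q
    refine mem_closure_of_tendsto hlim (Filter.Eventually.of_forall fun n => ?_)
    have hpos : 0 < 1 / ((n : ℝ) + 1) := by positivity
    have hle : 1 / ((n : ℝ) + 1) ≤ 1 := by
      rw [div_le_one (by positivity)]
      linarith [n.cast_nonneg (α := ℝ)]
    generalize 1 / ((n : ℝ) + 1) = a at hpos hle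
    have hb : 0 ≤ 1 - a := by linarith
    have ha := mul_pos hpos hM
    simp only [openTriangle, Set.mem_ofPred_eq, Prod.smul_fst, Prod.smul_snd, smul_eq_mul]
    refine ⟨?_, ?_, ?_⟩
    · nlinarith [mul_nonneg hb h1]
    · nlinarith [mul_nonneg hb h2]
    · nlinarith [mul_nonneg hb h3]

theorem mem_segment_prod {a b q : ℝ × ℝ} :
    q ∈ segment ℝ a b ↔ ∃ r : ℝ, 0 ≤ r ∧ r ≤ 1 ∧
      q.1 = (1 - r) * a.1 + r * b.1 ∧ q.2 = (1 - r) * a.2 + r * b.2 := by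
  rw [segment_eq_image]
  constructor
  · rintro ⟨r, ⟨h0, h1⟩, rfl⟩
    exact ⟨r, h0, h1, by simp, by simp⟩
  · rintro ⟨r, h0, h1, h2, h3⟩
    exact ⟨r, ⟨h0, h1⟩, Prod.ext (by simp [h2]) (by simp [h3])⟩

theorem smul_mem_segment_smul {c : ℝ} (hc : c ≠ 0) {a b q : ℝ × ℝ} :
    c • q ∈ segment ℝ (c • a) (c • b) ↔ q ∈ segment ℝ a b := by
  simp only [mem_segment_prod, Prod.smul_fst, Prod.smul_snd, smul_eq_mul]
  refine exists_congr fun r => and_congr_right fun _ => and_congr_right fun _ => ?_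
  rw [← mul_right_inj' hc (b := q.1), ← mul_right_inj' hc (b := q.2)]
  ring_nf

theorem boundary_triangle :
    closedTriangle 1 \ openTriangle 1 =
      ⋃ i : Fin 3, segment ℝ (trianglePt i) (trianglePt (i + 1)) := by
  ext q
  simp only [Set.mem_iUnion, Set.mem_sdiff, Fin.exists_fin_succ, mem_segment_prod]
  simp only [closedTriangle, openTriangle, Set.mem_ofPred_eq, trianglePt]
  obtain ⟨x, y⟩ := q
  simp
  constructor
  · rintro ⟨⟨h1, h2, h3⟩, h⟩
    by_cases k3 : y + x < 1
    · by_cases k1 : y < 1 + 2 * x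
      · right; right
        have h4 : 1 - x + 2 * y ≤ 0 := not_lt.1 fun h4 => absurd (h k1 h4) (not_le.2 k3)
        exact ⟨y + 1, by linarith, by linarith, by linarith, by linarith⟩
      · right; left
        exact ⟨-x, by linarith, by linarith, by linarith, by linarith⟩
    · left
      exact ⟨by linarith, by linarith, by linarith⟩
  · rintro (⟨h0, h1, h2⟩ | ⟨r, h0, h1, h2, h3⟩ | ⟨r, h0, h1, h2, h3⟩) <;>
      exact ⟨⟨by linarith, by linarith, by linarith⟩, by intros; linarith⟩

/-- `p` is a straight-line drawing of `G` without crossings, in which the triangle `t` is placed at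
`M • trianglePt` and no other part of the drawing meets the closed triangle. -/
structure StraightDrawing {V : Type*} (M : ℝ) (G : SimpleGraph V) (t : Fin 3 → V)
    (p : V → ℝ × ℝ) : Prop where
  injective : Function.Injective p
  eq_or_eq_of_mem_segment : ∀ u v, G.Adj u v → ∀ w, p w ∈ segment ℝ (p u) (p v) → w = u ∨ w = v
  segment_inter_segment : ∀ u v u' v', G.Adj u v → G.Adj u' v' → s(u, v) ≠ s(u', v') →
    segment ℝ (p u) (p v) ∩ segment ℝ (p u') (p v') ⊆ Set.range p
  apply_triangle : ∀ i, p (t i) = M • trianglePt i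
  exists_eq_of_mem_triangle : ∀ w, p w ∈ closedTriangle M → ∃ i, w = t i
  segment_inter_triangle : ∀ u v, G.Adj u v → ¬ ((∃ i, u = t i) ∧ ∃ j, v = t j) →
    ∀ q ∈ segment ℝ (p u) (p v), q ∈ closedTriangle M → ∃ i, q = p (t i)

namespace StraightDrawing

variable {V : Type*} {M : ℝ} {G : SimpleGraph V} {t : Fin 3 → V} {p : V → ℝ × ℝ}

/-- Allows integer coordinates with a large reference triangle to be normalized to size 1. -/
theorem smul (D : StraightDrawing M G t p) {c : ℝ} (hc : 0 < c) :
    StraightDrawing (c * M) G t (fun v => c • p v) where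
  injective := (smul_right_injective _ hc.ne').comp D.injective
  eq_or_eq_of_mem_segment u v h w hw :=
    D.eq_or_eq_of_mem_segment u v h w ((smul_mem_segment_smul hc.ne').1 hw)
  segment_inter_segment u v u' v' h h' hne q hq := by
    have hq' : q = c • c⁻¹ • q := (smul_inv_smul₀ hc.ne' q).symm
    rw [hq', Set.mem_inter_iff, smul_mem_segment_smul hc.ne', smul_mem_segment_smul hc.ne'] at hq
    obtain ⟨w, hw⟩ := D.segment_inter_segment u v u' v' h h' hne hq
    exact ⟨w, by rw [hq', ← hw]⟩
  apply_triangle i := by rw [D.apply_triangle, smul_smul]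
  exists_eq_of_mem_triangle w hw :=
    D.exists_eq_of_mem_triangle w ((smul_mem_closedTriangle hc).1 hw)
  segment_inter_triangle u v h hT q hq hq2 := by
    have hq' : q = c • c⁻¹ • q := (smul_inv_smul₀ hc.ne' q).symm
    rw [hq', smul_mem_segment_smul hc.ne'] at hq
    rw [hq', smul_mem_closedTriangle hc] at hq2
    obtain ⟨i, hi⟩ := D.segment_inter_triangle u v h hT _ hq hq2
    exact ⟨i, by rw [hq', ← hi]⟩

theorem map_iso (D : StraightDrawing M G t p) {W : Type*} {H : SimpleGraph W} (e : G ≃g H) :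
    StraightDrawing M H (fun i => e (t i)) (fun w => p (e.symm w)) where
  injective := D.injective.comp e.symm.injective
  eq_or_eq_of_mem_segment u v h w hw := by
    simpa using D.eq_or_eq_of_mem_segment _ _ (e.symm.map_adj_iff.2 h) _ hw
  segment_inter_segment u v u' v' h h' hne q hq := by
    obtain ⟨w, hw⟩ := D.segment_inter_segment _ _ _ _ (e.symm.map_adj_iff.2 h)
      (e.symm.map_adj_iff.2 h')
      (fun h => hne (by simpa using congrArg (Sym2.map e) h)) hq
    exact ⟨e w, by simpa using hw⟩
  apply_triangle i := by simpa using D.apply_triangle i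
  exists_eq_of_mem_triangle w hw := by
    obtain ⟨i, hi⟩ := D.exists_eq_of_mem_triangle _ hw
    exact ⟨i, by simp [← hi]⟩
  segment_inter_triangle u v h hT q hq hq2 := by
    obtain ⟨i, hi⟩ := D.segment_inter_triangle _ _ (e.symm.map_adj_iff.2 h)
      (fun ⟨⟨i, hi⟩, j, hj⟩ => hT ⟨⟨i, by simp [← hi]⟩, j, by simp [← hj]⟩) q hq hq2
    exact ⟨i, by simpa using hi⟩

/-- A straight-line drawing is a plane drawing. -/
def toPlaneDrawing (D : StraightDrawing M G t p) : PlaneDrawing G where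
  point := p
  arc := Sym2.lift ⟨fun u v => segment ℝ (p u) (p v), fun u v => segment_symm ℝ (p u) (p v)⟩
  point_injective := D.injective
  arc_simple u v h := by
    refine ⟨⟨⟨fun r => AffineMap.lineMap (p u) (p v) (r : ℝ), ?_⟩, by simp, by simp⟩, ?_, ?_⟩
    · exact AffineMap.lineMap_continuous.comp continuous_subtype_val
    · intro r s hrs
      exact Subtype.ext (AffineMap.lineMap_injective ℝ (D.injective.ne h.ne) hrs)
    · change _ = segment ℝ (p u) (p v)
      rw [segment_eq_image_lineMap]
      ext q
      simp [unitInterval]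
  mem_of_point_mem_arc e := by
    induction e using Sym2.ind with
    | _ u v =>
      intro h w hw
      simpa using D.eq_or_eq_of_mem_segment u v h w hw
  arc_inter_arc e he f hf := by
    induction e using Sym2.ind with
    | _ u v =>
      induction f using Sym2.ind with
      | _ u' v' => exact fun hne => D.segment_inter_segment u v u' v' he hf hne

/-- The open triangle is connected and avoids the drawing, while its frontier belongs to the
drawing. A connected subset of the complement that meets it therefore cannot leave it, so it is a
whole component. -/
theorem isFacialTriangle (D : StraightDrawing 1 G t p) (ht : ∀ i, G.Adj (t i) (t (i + 1))) :
    D.toPlaneDrawing.IsFacialTriangle t := by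
  have hbd : closedTriangle 1 \ openTriangle 1 =
      ⋃ i, D.toPlaneDrawing.arc s(t i, t (i + 1)) := by
    rw [boundary_triangle]
    refine Set.iUnion_congr fun i => ?_
    simp [toPlaneDrawing, D.apply_triangle]
  have hfr : frontier (openTriangle 1) = closedTriangle 1 \ openTriangle 1 := by
    rw [frontier, closure_openTriangle one_pos, (isOpen_openTriangle 1).interior_eq]
  have hsub : openTriangle 1 ⊆ closedTriangle 1 := by
    rw [← closure_openTriangle one_pos]; exact subset_closure
  have hcorner : ∀ i, p (t i) ∉ openTriangle 1 := by
    intro i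
    rw [D.apply_triangle]
    fin_cases i <;> norm_num [trianglePt, openTriangle]
  have h0 : (0 : ℝ × ℝ) ∈ openTriangle 1 := by simp [openTriangle]
  have hcompl : openTriangle 1 ⊆ D.toPlaneDrawing.carrierᶜ := by
    rintro q hq (⟨w, rfl⟩ | hmem)
    · obtain ⟨i, rfl⟩ := D.exists_eq_of_mem_triangle w (hsub hq)
      exact hcorner i hq
    · simp only [Set.mem_iUnion] at hmem
      obtain ⟨e, he, hqe⟩ := hmem
      induction e using Sym2.ind with
      | _ u v =>
        by_cases hT : (∃ i, u = t i) ∧ ∃ j, v = t j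
        · obtain ⟨⟨i, rfl⟩, j, rfl⟩ := hT
          have hij : i ≠ j := fun h => G.ne_of_adj he (congrArg t h)
          have : q ∈ ⋃ i, D.toPlaneDrawing.arc s(t i, t (i + 1)) := by
            rw [Set.mem_iUnion]
            have hne : ∀ i j : Fin 3, i ≠ j → j = i + 1 ∨ i = j + 1 := by decide
            rcases hne i j hij with rfl | rfl
            · exact ⟨_, hqe⟩
            · exact ⟨j, by rwa [Sym2.eq_swap]⟩
          rw [← hbd] at this
          exact this.2 hq
        · obtain ⟨i, rfl⟩ := D.segment_inter_triangle u v he hT q hqe (hsub hq)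
          exact hcorner i hq
  have hfc : frontier (openTriangle 1) ⊆ D.toPlaneDrawing.carrier := by
    rw [hfr, hbd]
    refine Set.iUnion_subset fun i => Set.subset_union_of_subset_right ?_ _
    exact Set.subset_biUnion_of_mem (u := D.toPlaneDrawing.arc) (ht i)
  refine ⟨ht, openTriangle 1, ⟨0, hcompl h0, ?_⟩, by rw [hfr, hbd]⟩
  refine subset_antisymm
    ((convex_openTriangle 1).isPreconnected.subset_connectedComponentIn h0 hcompl) ?_
  refine isPreconnected_connectedComponentIn.subset_left_of_subset_union
    (isOpen_openTriangle 1) (isClosed_closedTriangle 1).isOpen_compl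
    (Set.disjoint_compl_right_iff_subset.2 hsub) (fun q hq => ?_)
    ⟨0, mem_connectedComponentIn (hcompl h0), h0⟩
  by_contra hnot
  rw [Set.mem_union, not_or, Set.notMem_compl_iff] at hnot
  refine connectedComponentIn_subset _ _ hq (hfc ?_)
  rw [hfr]
  exact ⟨hnot.2, hnot.1⟩

end StraightDrawing

/-! ### Verifying a drawing with integer coordinates -/

/-- Twice the signed area of the triangle `a b c`. -/
def orient {R : Type*} [CommRing R] (a b c : R × R) : R :=
  (b.1 - a.1) * (c.2 - a.2) - (b.2 - a.2) * (c.1 - a.1)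

/-- Three linear forms, all nonnegative exactly on the triangle of size `M`. -/
def triangleForm {R : Type*} [CommRing R] (M : R) (q : R × R) (i : Fin 3) : R :=
  ![M + 2 * q.1 - q.2, M - q.1 + 2 * q.2, M - q.1 - q.2] i

/-- The corners of the reference triangle, with integer coordinates. -/
def trianglePtInt : Fin 3 → ℤ × ℤ := ![(1, 0), (0, 1), (-1, -1)]

/-- The point of the plane with the given integer coordinates. -/
def latticePt (a : ℤ × ℤ) : ℝ × ℝ := (a.1, a.2)

theorem latticePt_injective : Function.Injective latticePt := by
  rintro ⟨a, b⟩ ⟨c, d⟩ h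
  simpa [latticePt] using h

theorem latticePt_smul (M : ℤ) (a : ℤ × ℤ) : latticePt (M • a) = (M : ℝ) • latticePt a := by
  simp [latticePt]

theorem latticePt_trianglePtInt (i : Fin 3) : latticePt (trianglePtInt i) = trianglePt i := by
  fin_cases i <;> simp [latticePt, trianglePtInt, trianglePt]

theorem orient_latticePt (a b c : ℤ × ℤ) :
    orient (latticePt a) (latticePt b) (latticePt c) = (orient a b c : ℤ) := by
  simp [orient, latticePt]

theorem triangleForm_latticePt (M : ℤ) (a : ℤ × ℤ) (i : Fin 3) :
    triangleForm (M : ℝ) (latticePt a) i = (triangleForm M a i : ℤ) := by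
  fin_cases i <;> simp [triangleForm, latticePt]

theorem mem_closedTriangle_iff {M : ℝ} {q : ℝ × ℝ} :
    q ∈ closedTriangle M ↔ ∀ i, 0 ≤ triangleForm M q i := by
  simp [Fin.forall_fin_succ, triangleForm, closedTriangle]

theorem orient_of_mem_segment {a b c d q : ℝ × ℝ} (hq : q ∈ segment ℝ c d) :
    ∃ r : ℝ, 0 ≤ r ∧ r ≤ 1 ∧ orient a b q = (1 - r) * orient a b c + r * orient a b d := by
  obtain ⟨r, h0, h1, h2, h3⟩ := mem_segment_prod.1 hq
  exact ⟨r, h0, h1, by rw [orient, h2, h3, orient, orient]; ring⟩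

theorem orient_eq_zero_of_mem_segment {a b q : ℝ × ℝ} (hq : q ∈ segment ℝ a b) :
    orient a b q = 0 := by
  obtain ⟨r, h0, h1, h2⟩ := orient_of_mem_segment (a := a) (b := b) hq
  rw [h2]; simp only [orient]; ring

/-- The points c and d lie strictly on the same side of the line ab, so the segment cd misses that
line. -/
theorem notMem_segment_of_orient_mul_pos {a b c d q : ℝ × ℝ}
    (h : 0 < orient a b c * orient a b d) (hab : q ∈ segment ℝ a b) : q ∉ segment ℝ c d := by
  intro hcd
  obtain ⟨r, h0, h1, h2⟩ := orient_of_mem_segment (a := a) (b := b) hcd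
  rw [orient_eq_zero_of_mem_segment hab] at h2
  rcases h1.lt_or_eq with h1 | rfl
  -- Multiplying by `orient a b c` makes both summands nonnegative whichever side is the common one;
  -- the first is positive as long as r < 1.
  · have : 0 < (1 - r) * orient a b c ^ 2 + r * (orient a b c * orient a b d) := by
      have hc : orient a b c ≠ 0 := left_ne_zero_of_mul h.ne'
      have : 0 < 1 - r := by linarith
      positivity
    have h3 : (1 - r) * orient a b c ^ 2 + r * (orient a b c * orient a b d) =
      orient a b c * ((1 - r) * orient a b c + r * orient a b d) := by ring
    rw [h3, ← h2, mul_zero] at this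
    exact this.false
  · have : orient a b d = 0 := by linarith
    simp [this] at h

theorem eq_of_mem_segment_of_mem_segment {a b d q : ℝ × ℝ} (h : orient a b d ≠ 0)
    (hab : q ∈ segment ℝ a b) (had : q ∈ segment ℝ a d) : q = a := by
  obtain ⟨r, h0, h1, h2, h3⟩ := mem_segment_prod.1 had
  have h4 := orient_eq_zero_of_mem_segment hab
  have h5 : r * orient a b d = 0 := by
    rw [← h4]; simp only [orient, h2, h3]; ring
  obtain rfl := (mul_eq_zero.1 h5).resolve_right h
  exact Prod.ext (by simp [h2]) (by simp [h3])

/-- Where a linear form is negative at one end of a segment and nonpositive at the other, a point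
of the triangle can only be the other end. -/
theorem eq_right_of_triangleForm {M : ℝ} {a b q : ℝ × ℝ} (i : Fin 3)
    (ha : triangleForm M a i < 0) (hb : triangleForm M b i ≤ 0) (hq : q ∈ segment ℝ a b)
    (hM : q ∈ closedTriangle M) : q = b ∧ triangleForm M b i = 0 := by
  obtain ⟨r, h0, h1, h2, h3⟩ := mem_segment_prod.1 hq
  have h4 : triangleForm M q i = (1 - r) * triangleForm M a i + r * triangleForm M b i := by
    fin_cases i <;> simp [triangleForm, h2, h3] <;> ring
  have h5 := mem_closedTriangle_iff.1 hM i
  have h6 : r = 1 := by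
    by_contra hne
    have : r < 1 := lt_of_le_of_ne h1 hne
    nlinarith [mul_pos_of_neg_of_neg (sub_neg.2 this) ha]
  subst h6
  refine ⟨Prod.ext (by simp [h2]) (by simp [h3]), ?_⟩
  linarith

/-- A finite certificate for a straight-line drawing with integer coordinates. -/
theorem StraightDrawing.of_lattice {W : Type*} {G : SimpleGraph W} {T : Fin 3 → W} {M : ℤ}
    {P : W → ℤ × ℤ} (L : List (W × W))
    (hG : ∀ a b, G.Adj a b → (a, b) ∈ L ∨ (b, a) ∈ L)
    (hinj : ∀ a b, P a = P b → a = b)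
    (hcol : ∀ e ∈ L, ∀ w, w = e.1 ∨ w = e.2 ∨ orient (P e.1) (P e.2) (P w) ≠ 0)
    (hsep : ∀ e ∈ L, ∀ f ∈ L, e = f ∨ e.1 = f.1 ∨ e.1 = f.2 ∨ e.2 = f.1 ∨ e.2 = f.2 ∨
      0 < orient (P e.1) (P e.2) (P f.1) * orient (P e.1) (P e.2) (P f.2) ∨
      0 < orient (P f.1) (P f.2) (P e.1) * orient (P f.1) (P f.2) (P e.2))
    (hT : ∀ i, P (T i) = M • trianglePtInt i)
    (hout : ∀ w, (∃ i, w = T i) ∨ ∃ i, triangleForm M (P w) i < 0)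
    (htri : ∀ e ∈ L, ((∃ i, e.1 = T i) ∧ ∃ i, e.2 = T i) ∨ ∃ i,
      (triangleForm M (P e.1) i < 0 ∧ triangleForm M (P e.2) i < 0) ∨
      (triangleForm M (P e.1) i < 0 ∧ triangleForm M (P e.2) i = 0 ∧ ∃ j, e.2 = T j) ∨
      (triangleForm M (P e.2) i < 0 ∧ triangleForm M (P e.1) i = 0 ∧ ∃ j, e.1 = T j)) :
    StraightDrawing (M : ℝ) G T (fun w => latticePt (P w)) where
  injective a b h := hinj a b (latticePt_injective h)
  eq_or_eq_of_mem_segment u v h w hw := by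
    have key : ∀ e ∈ L, latticePt (P w) ∈ segment ℝ (latticePt (P e.1)) (latticePt (P e.2)) →
        w = e.1 ∨ w = e.2 := by
      intro e he hw
      rcases hcol e he w with h | h | h
      · exact Or.inl h
      · exact Or.inr h
      · have := orient_eq_zero_of_mem_segment hw
        rw [orient_latticePt] at this
        exact absurd (by exact_mod_cast this) h
    rcases hG u v h with h | h
    · exact key _ h hw
    · exact (key _ h (by rwa [segment_symm])).symm
  segment_inter_segment u v u' v' h h' hne q hq := by
    -- Edges with a common end a need no separation test: the other end d is off the line ab by
    -- `hcol`, so the edges meet only in a.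
    have share : ∀ a b d, (∀ w, w = a ∨ w = b ∨ orient (P a) (P b) (P w) ≠ 0) →
        s(a, b) ≠ s(a, d) → q ∈ segment ℝ (latticePt (P a)) (latticePt (P b)) →
        q ∈ segment ℝ (latticePt (P a)) (latticePt (P d)) →
        q ∈ Set.range fun w => latticePt (P w) := by
      intro a b d hcol hne hab had
      refine ⟨a, ?_⟩
      rcases hcol d with rfl | rfl | h
      · rw [segment_same, Set.mem_singleton_iff] at had
        exact had.symm
      · exact absurd rfl hne
      · refine (eq_of_mem_segment_of_mem_segment ?_ hab had).symm
        rw [orient_latticePt]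
        exact_mod_cast h
    have hcol' : ∀ e ∈ L, ∀ w, w = e.2 ∨ w = e.1 ∨ orient (P e.2) (P e.1) (P w) ≠ 0 := by
      intro e he w
      rcases hcol e he w with h | h | h
      · exact Or.inr (Or.inl h)
      · exact Or.inl h
      · refine Or.inr (Or.inr fun h0 => h ?_)
        rw [← neg_eq_zero, ← h0]
        simp only [orient]
        ring
    have key : ∀ e ∈ L, ∀ f ∈ L, s(e.1, e.2) ≠ s(f.1, f.2) →
        q ∈ segment ℝ (latticePt (P e.1)) (latticePt (P e.2)) →
        q ∈ segment ℝ (latticePt (P f.1)) (latticePt (P f.2)) →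
        q ∈ Set.range fun w => latticePt (P w) := by
      rintro ⟨a, b⟩ he ⟨c, d⟩ hf hne hab hcd
      rcases hsep _ he _ hf with h | h | h | h | h | h | h
      · exact absurd (by rw [h]) hne
      · obtain rfl : a = c := h
        exact share a b d (hcol _ he) hne hab hcd
      · obtain rfl : a = d := h
        exact share a b c (hcol _ he) (by rwa [Sym2.eq_swap (a := a) (b := c)]) hab
          (by rwa [segment_symm])
      · obtain rfl : b = c := h
        exact share b a d (hcol' _ he) (by rwa [Sym2.eq_swap (a := b) (b := a)])
          (by rwa [segment_symm]) hcd
      · obtain rfl : b = d := h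
        exact share b a c (hcol' _ he)
          (by rwa [Sym2.eq_swap (a := b) (b := a), Sym2.eq_swap (a := b) (b := c)])
          (by rwa [segment_symm]) (by rwa [segment_symm])
      · refine absurd hcd (notMem_segment_of_orient_mul_pos ?_ hab)
        simp only [orient_latticePt]
        exact_mod_cast h
      · refine absurd hab (notMem_segment_of_orient_mul_pos ?_ hcd)
        simp only [orient_latticePt]
        exact_mod_cast h
    obtain ⟨hq, hq'⟩ := hq
    rcases hG u v h with h | h <;> rcases hG u' v' h' with h' | h'
    · exact key _ h _ h' hne hq hq'
    · exact key _ h _ h' (by rwa [Sym2.eq_swap (a := v')]) hq (by rwa [segment_symm])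
    · exact key _ h _ h' (by rwa [Sym2.eq_swap (a := v)]) (by rwa [segment_symm]) hq'
    · exact key _ h _ h' (by rwa [Sym2.eq_swap (a := v), Sym2.eq_swap (a := v')])
        (by rwa [segment_symm]) (by rwa [segment_symm])
  apply_triangle i := by rw [hT, latticePt_smul, latticePt_trianglePtInt]
  exists_eq_of_mem_triangle w hw := by
    refine (hout w).resolve_right ?_
    rintro ⟨i, hi⟩
    have := mem_closedTriangle_iff.1 hw i
    rw [triangleForm_latticePt] at this
    exact hi.not_ge (by exact_mod_cast this)
  segment_inter_triangle u v h hnT q hq hqM := by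
    have key : ∀ e ∈ L, ¬ ((∃ i, e.1 = T i) ∧ ∃ i, e.2 = T i) →
        q ∈ segment ℝ (latticePt (P e.1)) (latticePt (P e.2)) → ∃ i, q = latticePt (P (T i)) := by
      intro e he hnT hq
      obtain ⟨i, hi⟩ := (htri e he).resolve_left hnT
      have hcast : ∀ w, triangleForm (M : ℝ) (latticePt (P w)) i = triangleForm M (P w) i :=
        fun w => triangleForm_latticePt M _ i
      have hneg : ∀ w, triangleForm M (P w) i < 0 →
          triangleForm (M : ℝ) (latticePt (P w)) i < 0 := fun w hw => by
        rw [hcast]; exact_mod_cast hw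
      rcases hi with ⟨h1, h2⟩ | ⟨h1, h2, j, hj⟩ | ⟨h1, h2, j, hj⟩
      · exact absurd (eq_right_of_triangleForm i (hneg _ h1) (hneg _ h2).le hq hqM).2
          (hneg _ h2).ne
      · exact ⟨j, hj ▸ (eq_right_of_triangleForm i (hneg _ h1) (by rw [hcast, h2]; simp) hq hqM).1⟩
      · rw [segment_symm] at hq
        exact ⟨j, hj ▸ (eq_right_of_triangleForm i (hneg _ h1) (by rw [hcast, h2]; simp) hq hqM).1⟩
    rcases hG u v h with h | h
    · exact key _ h hnT hq
    · exact key _ h (fun h => hnT h.symm) (by rwa [segment_symm])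

/-! ### The gadget and the drawing of a crowning -/

namespace SimpleGraph

variable {V : Type*} {G : SimpleGraph V} {t : Fin 3 → V}

/-- The corner `z (i + 1)` of the central triangle of a crowning. Its numbering starts at
`z 1`, which lies opposite to `t 0`. -/
def crownTriangle (V : Type*) (i : Fin 3) : CrownVertex V := .inr (.inr (.inr (i + 1)))

/-- The gadget of a crowning is the crowning of a triangle. -/
abbrev gadget : SimpleGraph (CrownVertex (Fin 3)) := (⊤ : SimpleGraph (Fin 3)).crown id

/-- The vertices of the gadget as vertices of a crowning. -/
abbrev ofGadget (t : Fin 3 → V) : CrownVertex (Fin 3) → CrownVertex V := Sum.map t id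

/-- The edges of the gadget. -/
def gadgetEdges : List (CrownVertex (Fin 3) × CrownVertex (Fin 3)) :=
  (List.finRange 3).flatMap fun i =>
    [(.inl i, .inr (.inl i)), (.inr (.inl i), .inr (.inr (.inl i))),
      (.inl (i + 1), .inr (.inr (.inl i))), (.inr (.inl (i + 1)), .inr (.inr (.inl i))),
      (.inr (.inr (.inr i)), .inr (.inl i)), (.inr (.inr (.inr i)), .inr (.inr (.inl i))),
      (.inr (.inr (.inr i)), .inr (.inr (.inr (i + 1))))]

instance : DecidableRel ((⊤ : SimpleGraph (Fin 3)).crownRel id)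
  | .inl u, .inl v => inferInstanceAs (Decidable ((⊤ : SimpleGraph (Fin 3)).Adj u v ∧
      ¬ ((∃ i, u = id i) ∧ ∃ j, v = id j)))
  | .inl u, .inr (.inl i) => inferInstanceAs (Decidable (u = id i))
  | .inl u, .inr (.inr (.inl i)) => inferInstanceAs (Decidable (u = id (i + 1)))
  | .inl _, .inr (.inr (.inr _)) => inferInstanceAs (Decidable False)
  | .inr (.inl _), .inl _ => inferInstanceAs (Decidable False)
  | .inr (.inl _), .inr (.inl _) => inferInstanceAs (Decidable False)
  | .inr (.inl i), .inr (.inr (.inl j)) => inferInstanceAs (Decidable (i = j ∨ i = j + 1))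
  | .inr (.inl _), .inr (.inr (.inr _)) => inferInstanceAs (Decidable False)
  | .inr (.inr (.inl _)), .inl _ => inferInstanceAs (Decidable False)
  | .inr (.inr (.inl _)), .inr _ => inferInstanceAs (Decidable False)
  | .inr (.inr (.inr _)), .inl _ => inferInstanceAs (Decidable False)
  | .inr (.inr (.inr i)), .inr (.inl j) => inferInstanceAs (Decidable (i = j))
  | .inr (.inr (.inr i)), .inr (.inr (.inl j)) => inferInstanceAs (Decidable (i = j))
  | .inr (.inr (.inr i)), .inr (.inr (.inr j)) => inferInstanceAs (Decidable (i ≠ j))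

instance : DecidableRel gadget.Adj := fun a b =>
  inferInstanceAs (Decidable (a ≠ b ∧ (_ ∨ _)))

instance (e : CrownVertex (Fin 3) × CrownVertex (Fin 3)) : Decidable (e ∈ gadgetEdges) :=
  @List.instDecidableMemOfLawfulBEq _ instBEqOfDecidableEq _ e gadgetEdges

theorem gadget_adj_iff (a b : CrownVertex (Fin 3)) :
    gadget.Adj a b ↔ (a, b) ∈ gadgetEdges ∨ (b, a) ∈ gadgetEdges := by
  revert a b
  decide +kernel

/-- Splits a crowning into the old edges outside the triangle and a copy of the gadget, so that each
later claim reduces to G and to one fixed finite graph. -/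
theorem crown_adj_iff {a b : CrownVertex V} :
    (G.crown t).Adj a b ↔
      (∃ u v, G.Adj u v ∧ ¬ ((∃ i, u = t i) ∧ ∃ j, v = t j) ∧ a = .inl u ∧ b = .inl v) ∨
      ∃ w w', gadget.Adj w w' ∧ a = ofGadget t w ∧ b = ofGadget t w' := by
  rcases a with u | i | i | i <;> rcases b with v | j | j | j <;>
    simp [crown, crownRel, Sum.exists]
  have hne : G.Adj u v → u ≠ v := G.ne_of_adj
  have hsymm : G.Adj v u ↔ G.Adj u v := G.adj_comm v u
  grind

/-- Integer coordinates of the gadget, with the central triangle as reference triangle. -/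
def gadgetPt : CrownVertex (Fin 3) → ℤ × ℤ
  | .inl i => -(14 * trianglePtInt i)
  | .inr (.inl i) => -(7 * trianglePtInt i + 6 * trianglePtInt (i + 1) + trianglePtInt (i + 2))
  | .inr (.inr (.inl i)) =>
      -(6 * trianglePtInt i + 7 * trianglePtInt (i + 1) + trianglePtInt (i + 2))
  | .inr (.inr (.inr i)) => trianglePtInt (i + 2)

/-- The reference corners sum to 0 and the weights 7, 6, 1 to 14, so x i and y i lie just inside the
side from t i to t (i + 1) of the outer triangle. The minus sign makes z i point towards the
midpoint of that side. -/
theorem gadget_straightDrawing :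
    StraightDrawing 1 gadget (crownTriangle (Fin 3)) (fun w => latticePt (gadgetPt w)) := by
  have h := StraightDrawing.of_lattice (M := 1) (P := gadgetPt) (T := crownTriangle (Fin 3))
    gadgetEdges (fun a b => (gadget_adj_iff a b).1) (by decide +kernel) (by decide +kernel)
    (by decide +kernel) (by decide +kernel) (by decide +kernel) (by decide +kernel)
  simpa using h

theorem triangleForm_gadgetPt (w : CrownVertex (Fin 3)) (i : Fin 3) :
    0 ≤ triangleForm 14 (-gadgetPt w) i := by
  revert w i
  decide +kernel

/-- The whole gadget is drawn in the triangle spanned by its corners. -/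
theorem gadget_mem_closedTriangle {w w' : CrownVertex (Fin 3)} {q : ℝ × ℝ}
    (hq : q ∈ segment ℝ (latticePt (gadgetPt w)) (latticePt (gadgetPt w'))) :
    (-14 : ℝ)⁻¹ • q ∈ closedTriangle 1 := by
  have key : ∀ w, (-14 : ℝ)⁻¹ • latticePt (gadgetPt w) ∈ closedTriangle 1 := by
    intro w
    rw [← smul_mem_closedTriangle (c := 14) (by norm_num), mem_closedTriangle_iff]
    intro i
    have h := triangleForm_gadgetPt w i
    rw [← Int.cast_nonneg_iff (R := ℝ), ← triangleForm_latticePt] at h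
    have hq : (14 : ℝ) • (-14 : ℝ)⁻¹ • latticePt (gadgetPt w) = latticePt (-gadgetPt w) := by
      rw [smul_smul]
      norm_num
      ext <;> simp [latticePt]
    rw [hq]
    simpa using h
  refine (convex_closedTriangle 1).segment_subset (key w) (key w') ?_
  rwa [smul_mem_segment_smul (by norm_num)]

theorem closedTriangle_subset_gadget {q : ℝ × ℝ} (hq : q ∈ closedTriangle 1) :
    (-14 : ℝ)⁻¹ • q ∈ closedTriangle 1 := by
  obtain ⟨h1, h2, h3⟩ := hq
  refine ⟨?_, ?_, ?_⟩ <;> simp <;> linarith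

/-- The drawing of a crowning: the gadget is put into the triangle. -/
def crownPt (p : V → ℝ × ℝ) : CrownVertex V → ℝ × ℝ
  | .inl u => (-14 : ℝ) • p u
  | .inr w => latticePt (gadgetPt (.inr w))

theorem crownPt_ofGadget {p : V → ℝ × ℝ} (D : StraightDrawing 1 G t p)
    (w : CrownVertex (Fin 3)) : crownPt p (ofGadget t w) = latticePt (gadgetPt w) := by
  rcases w with i | w
  · simp only [crownPt, ofGadget, Sum.map_inl, D.apply_triangle, gadgetPt, one_smul]
    rw [← latticePt_trianglePtInt]
    ext <;> simp [latticePt]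
  · rfl

/-- Scaling the old drawing by -14 puts its empty triangle exactly onto the outer triangle of the
gadget. The gadget stays inside that triangle and the remaining old edges meet it only in corners,
so old and new edges can only meet at corners. -/
theorem crown_straightDrawing {p : V → ℝ × ℝ} (D : StraightDrawing 1 G t p) :
    StraightDrawing 1 (G.crown t) (crownTriangle V) (crownPt p) := by
  have hc : (-14 : ℝ) ≠ 0 := by norm_num
  have hg := crownPt_ofGadget D
  have hinr : ∀ w, crownPt p (.inr w) = latticePt (gadgetPt (.inr w)) := fun w => rfl
  have hinl : ∀ u, crownPt p (.inl u) = (-14 : ℝ) • p u := fun u => rfl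
  have hginj : Function.Injective fun w => latticePt (gadgetPt w) :=
    gadget_straightDrawing.injective
  have hin : ∀ a, (-14 : ℝ)⁻¹ • crownPt p a ∈ closedTriangle 1 → ∃ w, a = ofGadget t w := by
    rintro (u | w) h
    · rw [hinl, inv_smul_smul₀ hc] at h
      obtain ⟨i, rfl⟩ := D.exists_eq_of_mem_triangle u h
      exact ⟨.inl i, rfl⟩
    · exact ⟨.inr w, rfl⟩
  have hmem : ∀ w, (-14 : ℝ)⁻¹ • latticePt (gadgetPt w) ∈ closedTriangle 1 := fun w =>
    gadget_mem_closedTriangle (left_mem_segment ℝ _ (latticePt (gadgetPt w)))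
  -- The only contact between an old edge and the region of the gadget is at a corner.
  have hold : ∀ u v, G.Adj u v → ¬ ((∃ i, u = t i) ∧ ∃ j, v = t j) → ∀ q,
      q ∈ segment ℝ (crownPt p (.inl u)) (crownPt p (.inl v)) →
      (-14 : ℝ)⁻¹ • q ∈ closedTriangle 1 → ∃ i, q = latticePt (gadgetPt (.inl i)) := by
    intro u v huv hT q hq hq'
    rw [hinl, hinl, ← smul_inv_smul₀ hc q, smul_mem_segment_smul hc] at hq
    obtain ⟨i, hi⟩ := D.segment_inter_triangle u v huv hT _ hq hq'
    exact ⟨i, by rw [← hg, ofGadget, Sum.map_inl, hinl, ← hi, smul_inv_smul₀ hc]⟩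
  refine ⟨?_, ?_, ?_, ?_, ?_, ?_⟩
  · have hmix : ∀ u w, crownPt p (.inl u) ≠ crownPt p (.inr w) := by
      intro u w h
      obtain ⟨w', hw'⟩ := hin (.inl u) (by rw [h]; exact hmem _)
      rw [hw', hg, hinr] at h
      have := hginj h
      subst this
      simp at hw'
    rintro (u | w) (v | w') h
    · exact congrArg _ (D.injective (smul_right_injective _ hc h))
    · exact absurd h (hmix u w')
    · exact absurd h.symm (hmix v w)
    · exact congrArg _ (Sum.inr_injective (hginj h))
  · intro a b hab c hcs
    rcases crown_adj_iff.1 hab with ⟨u, v, huv, hT, rfl, rfl⟩ | ⟨w, w', hww, rfl, rfl⟩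
    · rcases c with x | w
      · have := D.eq_or_eq_of_mem_segment u v huv x ((smul_mem_segment_smul hc).1 hcs)
        simpa using this
      · obtain ⟨i, hi⟩ := hold u v huv hT _ hcs (hmem _)
        simpa using hginj hi
    · rw [hg, hg] at hcs
      obtain ⟨x, rfl⟩ := hin c (gadget_mem_closedTriangle hcs)
      rw [hg] at hcs
      rcases gadget_straightDrawing.eq_or_eq_of_mem_segment w w' hww x hcs with rfl | rfl
      · exact Or.inl rfl
      · exact Or.inr rfl
  · intro a b a' b' hab hab' hne q ⟨hq, hq'⟩
    rcases crown_adj_iff.1 hab with ⟨u, v, huv, hT, rfl, rfl⟩ | ⟨w, w', hww, rfl, rfl⟩ <;>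
      rcases crown_adj_iff.1 hab' with ⟨u', v', huv', hT', rfl, rfl⟩ | ⟨x, x', hxx, rfl, rfl⟩
    · rw [hinl, hinl, ← smul_inv_smul₀ hc q, smul_mem_segment_smul hc] at hq hq'
      obtain ⟨y, hy⟩ := D.segment_inter_segment u v u' v' huv huv'
        (fun h => hne (by simpa using h)) ⟨hq, hq'⟩
      exact ⟨.inl y, by rw [hinl, hy, smul_inv_smul₀ hc]⟩
    · rw [hg, hg] at hq'
      obtain ⟨i, rfl⟩ := hold u v huv hT q hq (gadget_mem_closedTriangle hq')
      exact ⟨_, hg _⟩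
    · rw [hg, hg] at hq
      obtain ⟨i, rfl⟩ := hold u' v' huv' hT' q hq' (gadget_mem_closedTriangle hq)
      exact ⟨_, hg _⟩
    · rw [hg, hg] at hq hq'
      obtain ⟨y, rfl⟩ := gadget_straightDrawing.segment_inter_segment w w' x x' hww hxx
        (fun h => hne (by simpa using congrArg (Sym2.map (ofGadget t)) h)) ⟨hq, hq'⟩
      exact ⟨_, hg _⟩
  · exact fun i => gadget_straightDrawing.apply_triangle i
  · intro a ha
    obtain ⟨w, rfl⟩ := hin a (closedTriangle_subset_gadget ha)
    rw [hg] at ha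
    obtain ⟨i, rfl⟩ := gadget_straightDrawing.exists_eq_of_mem_triangle w ha
    exact ⟨i, rfl⟩
  · intro a b hab hT q hq hqt
    rcases crown_adj_iff.1 hab with ⟨u, v, huv, hT', rfl, rfl⟩ | ⟨w, w', hww, rfl, rfl⟩
    · obtain ⟨i, rfl⟩ := hold u v huv hT' q hq (closedTriangle_subset_gadget hqt)
      obtain ⟨j, hj⟩ := gadget_straightDrawing.exists_eq_of_mem_triangle _ hqt
      simp [crownTriangle] at hj
    · rw [hg, hg] at hq
      refine gadget_straightDrawing.segment_inter_triangle w w' hww ?_ q hq hqt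
      rintro ⟨⟨i, rfl⟩, j, rfl⟩
      exact hT ⟨⟨i, rfl⟩, j, rfl⟩

/-! ### Colorings and degrees of a crowning -/

/-- The map that folds a crowning onto the original graph. -/
def crownFold (t : Fin 3 → V) : CrownVertex V → V
  | .inl u => u
  | .inr (.inl i) => t (i + 1)
  | .inr (.inr (.inl i)) => t i
  | .inr (.inr (.inr i)) => t (i + 2)

theorem crownFold_ofGadget (w : CrownVertex (Fin 3)) :
    crownFold t (ofGadget t w) = t (crownFold id w) := by
  rcases w with i | i | i | i <;> rfl

theorem crownFold_id_ne : ∀ w w', gadget.Adj w w' → crownFold id w ≠ crownFold id w' := by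
  decide +kernel

theorem adj_of_adj_succ (ht : ∀ i, G.Adj (t i) (t (i + 1))) {i j : Fin 3} (hij : i ≠ j) :
    G.Adj (t i) (t j) := by
  have h : ∀ i j : Fin 3, i ≠ j → j = i + 1 ∨ i = j + 1 := by decide
  rcases h i j hij with rfl | rfl
  · exact ht i
  · exact (ht j).symm

theorem injective_of_adj_succ (ht : ∀ i, G.Adj (t i) (t (i + 1))) : Function.Injective t := by
  intro i j h
  by_contra hij
  exact G.ne_of_adj (adj_of_adj_succ ht hij) h

/-- Adjacent gadget vertices fold to different corners, and the corners are pairwise adjacent in G;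
thus folding is a homomorphism. -/
theorem adj_crownFold (ht : ∀ i, G.Adj (t i) (t (i + 1))) {a b : CrownVertex V}
    (hab : (G.crown t).Adj a b) : G.Adj (crownFold t a) (crownFold t b) := by
  rcases crown_adj_iff.1 hab with ⟨u, v, huv, -, rfl, rfl⟩ | ⟨w, w', hww, rfl, rfl⟩
  · exact huv
  · rw [crownFold_ofGadget, crownFold_ofGadget]
    exact adj_of_adj_succ ht (crownFold_id_ne w w' hww)

theorem crown_adj_triangle (i : Fin 3) :
    (G.crown t).Adj (crownTriangle V i) (crownTriangle V (i + 1)) := by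
  refine crown_adj_iff.2 (Or.inr ⟨crownTriangle (Fin 3) i, crownTriangle (Fin 3) (i + 1),
    ?_, rfl, rfl⟩)
  revert i
  decide +kernel

theorem IsFoldColoring.crown {b m : ℕ} {c : V → Finset (Fin m)} (hc : G.IsFoldColoring b m c)
    (ht : ∀ i, G.Adj (t i) (t (i + 1))) :
    (G.crown t).IsFoldColoring b m (fun a => c (crownFold t a)) :=
  ⟨fun _ => hc.1 _, fun _ _ hab => hc.2 _ _ (adj_crownFold ht hab)⟩

set_option synthInstance.maxSize 2000 in
set_option synthInstance.maxHeartbeats 400000 in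
-- Up to renaming, z i has color i, so (x i, y i) is colored (i + 1, i + 2) or (i + 2, i + 1). The
-- edges from y i to x (i + 1) forbid the first pattern at two consecutive indices, hence it occurs
-- at most once. The corner colors are then forced, and they differ both when it occurs once and
-- when it never occurs. The check is by enumeration; each constraint directly follows its
-- quantifier to prune the search.
theorem gadget_corners_ne : ∀ z₀ z₁ : Fin 3, z₀ ≠ z₁ → ∀ z₂, z₂ ≠ z₀ → z₂ ≠ z₁ →
    ∀ x₀, x₀ ≠ z₀ → ∀ y₀, y₀ ≠ z₀ → y₀ ≠ x₀ → ∀ x₁, x₁ ≠ z₁ → x₁ ≠ y₀ →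
    ∀ y₁, y₁ ≠ z₁ → y₁ ≠ x₁ → ∀ x₂, x₂ ≠ z₂ → x₂ ≠ y₁ → ∀ y₂, y₂ ≠ z₂ → y₂ ≠ x₂ → y₂ ≠ x₀ →
    ∀ t₀, t₀ ≠ x₀ → t₀ ≠ y₂ → ∀ t₁, t₁ ≠ x₁ → t₁ ≠ y₀ → ∀ t₂, t₂ ≠ x₂ → t₂ ≠ y₁ →
    t₀ ≠ t₁ ∧ t₁ ≠ t₂ ∧ t₂ ≠ t₀ := by
  decide +kernel

/-- Every 3-coloring of the gadget gives different colors to the three corners. -/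
theorem gadget_coloring_corners (c : gadget.Coloring (Fin 3)) {i j : Fin 3} (hij : i ≠ j) :
    c (.inl i) ≠ c (.inl j) := by
  have h : ∀ a b, gadget.Adj a b → c a ≠ c b := fun a b hab => c.valid hab
  obtain ⟨h01, h12, h20⟩ := gadget_corners_ne
    (c (.inr (.inr (.inr 0)))) (c (.inr (.inr (.inr 1)))) (h _ _ (by decide))
    (c (.inr (.inr (.inr 2)))) (h _ _ (by decide)) (h _ _ (by decide))
    (c (.inr (.inl 0))) (h _ _ (by decide))
    (c (.inr (.inr (.inl 0)))) (h _ _ (by decide)) (h _ _ (by decide))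
    (c (.inr (.inl 1))) (h _ _ (by decide)) (h _ _ (by decide))
    (c (.inr (.inr (.inl 1)))) (h _ _ (by decide)) (h _ _ (by decide))
    (c (.inr (.inl 2))) (h _ _ (by decide)) (h _ _ (by decide))
    (c (.inr (.inr (.inl 2)))) (h _ _ (by decide)) (h _ _ (by decide)) (h _ _ (by decide))
    (c (.inl 0)) (h _ _ (by decide)) (h _ _ (by decide))
    (c (.inl 1)) (h _ _ (by decide)) (h _ _ (by decide))
    (c (.inl 2)) (h _ _ (by decide)) (h _ _ (by decide))
  fin_cases i <;> fin_cases j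
  exacts [absurd rfl hij, h01, h20.symm, h01.symm, absurd rfl hij, h12, h20, h12.symm,
    absurd rfl hij]

/-- The gadget forces different colors on the corners, so restricting to the old vertices also
respects the removed triangle edges. -/
theorem Colorable.of_crown (h : (G.crown t).Colorable 3) : G.Colorable 3 := by
  obtain ⟨c⟩ := h
  let g : gadget.Coloring (Fin 3) := Coloring.mk (fun w => c (ofGadget t w)) fun hww =>
    c.valid (crown_adj_iff.2 (Or.inr ⟨_, _, hww, rfl, rfl⟩))
  refine ⟨Coloring.mk (fun u => c (.inl u)) @fun u v huv => ?_⟩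
  by_cases hT : (∃ i, u = t i) ∧ ∃ j, v = t j
  · obtain ⟨⟨i, rfl⟩, j, rfl⟩ := hT
    exact gadget_coloring_corners g fun h => G.ne_of_adj huv (congrArg t h)
  · exact c.valid (crown_adj_iff.2 (Or.inl ⟨u, v, huv, hT, rfl, rfl⟩))

/-- Coloring number `k` of the gadget, turned by `i`; exactly one edge has two ends of the same
color. -/
def gadgetColoring (i : Fin 3) (k : Fin 7) : CrownVertex (Fin 3) → Fin 3
  | .inl a => if a = i + (![0, 0, 0, 2, 0, 0, 0] k + 2) then 1 else 0
  | .inr (.inl a) => (![![0, 1, 0], ![2, 1, 0], ![1, 1, 0], ![1, 0, 1], ![2, 2, 2], ![1, 1, 0],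
      ![1, 1, 0]] : Fin 7 → Fin 3 → Fin 3) k (a - i)
  | .inr (.inr (.inl a)) => (![![2, 2, 1], ![2, 2, 1], ![0, 2, 2], ![0, 2, 2], ![1, 0, 1],
      ![2, 2, 2], ![2, 2, 2]] : Fin 7 → Fin 3 → Fin 3) k (a - i)
  | .inr (.inr (.inr a)) => (![![1, 0, 2], ![1, 0, 2], ![2, 0, 1], ![2, 1, 0], ![2, 1, 0],
      ![2, 0, 1], ![0, 0, 1]] : Fin 7 → Fin 3 → Fin 3) k (a - i)

/-- Rotation splits the 21 edges of the gadget into seven orbits, one for each value of k. -/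
theorem gadgetColoring_valid : ∀ e ∈ gadgetEdges, ∃ i k, ∀ f ∈ gadgetEdges,
    f = e ∨ gadgetColoring i k f.1 ≠ gadgetColoring i k f.2 := by
  decide +kernel

/-- Deleting an edge of the gadget permits a 3-coloring in which only two corners have the same
color. -/
theorem exists_gadget_coloring {w w' : CrownVertex (Fin 3)} (h : gadget.Adj w w') :
    ∃ (j : Fin 3) (g : CrownVertex (Fin 3) → Fin 3),
      (∀ a, g (.inl a) = if a = j + 2 then 1 else 0) ∧
      ∀ x x', gadget.Adj x x' → s(x, x') ≠ s(w, w') → g x ≠ g x' := by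
  obtain ⟨e, he, hew⟩ : ∃ e ∈ gadgetEdges, s(w, w') = s(e.1, e.2) := by
    rcases (gadget_adj_iff w w').1 h with h | h
    exacts [⟨_, h, rfl⟩, ⟨_, h, Sym2.eq_swap⟩]
  obtain ⟨i, k, hik⟩ := gadgetColoring_valid e he
  refine ⟨i + ![0, 0, 0, 2, 0, 0, 0] k, gadgetColoring i k, fun a => ?_, fun x x' hx hne => ?_⟩
  · rw [add_assoc]; rfl
  · rw [hew] at hne
    rcases (gadget_adj_iff x x').1 hx with h | h
    · exact (hik _ h).resolve_left fun h => hne (by rw [← h])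
    · exact ((hik _ h).resolve_left fun h => hne (by rw [← h, Sym2.eq_swap])).symm

/-- Two of the corners of a triangle get the same color when the edge between them is deleted. -/
theorem exists_coloring_deleteEdges (ht : ∀ i, G.Adj (t i) (t (i + 1))) (h3 : ¬ G.Colorable 3)
    (j : Fin 3) (hcr : (G.deleteEdges {s(t j, t (j + 1))}).Colorable 3) :
    ∃ c : V → Fin 3, (∀ a, c (t a) = if a = j + 2 then 1 else 0) ∧
      ∀ u v, G.Adj u v → ¬ ((∃ i, u = t i) ∧ ∃ j, v = t j) → c u ≠ c v := by
  obtain ⟨c⟩ := hcr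
  have hval : ∀ u v, G.Adj u v → s(u, v) ≠ s(t j, t (j + 1)) → c u ≠ c v := fun u v huv hne =>
    c.valid (deleteEdges_adj.2 ⟨huv, hne⟩)
  -- Otherwise c would be a 3-coloring of G itself.
  have heq : c (t j) = c (t (j + 1)) := by
    by_contra hne
    refine h3 ⟨Coloring.mk c @fun u v huv => ?_⟩
    by_cases h : s(u, v) = s(t j, t (j + 1))
    · rcases Sym2.eq_iff.1 h with ⟨rfl, rfl⟩ | ⟨rfl, rfl⟩
      exacts [hne, Ne.symm hne]
    · exact hval u v huv h
  have hinj := injective_of_adj_succ ht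
  have e01 : ∀ j : Fin 3, j + 1 ≠ j + 2 := by decide
  have e02 : ∀ j : Fin 3, j ≠ j + 2 := by decide
  have hcases : ∀ j a : Fin 3, a = j ∨ a = j + 1 ∨ a = j + 2 := by decide
  have hne : c (t j) ≠ c (t (j + 2)) := by
    refine hval _ _ (adj_of_adj_succ ht (e02 j)) fun h => ?_
    rcases Sym2.eq_iff.1 h with ⟨-, h⟩ | ⟨-, h⟩
    · exact e01 j (hinj h).symm
    · exact e02 j (hinj h).symm
  -- Renames the colors to match the normalization of `gadgetColoring`: color 0 on the two equal
  -- corners, 1 on the third.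
  obtain ⟨σ, hσ0, hσ1⟩ : ∃ σ : Equiv.Perm (Fin 3), σ (c (t j)) = 0 ∧ σ (c (t (j + 2))) = 1 := by
    generalize c (t j) = a at hne
    generalize c (t (j + 2)) = b at hne
    revert a b
    decide
  refine ⟨fun v => σ (c v), fun a => ?_, fun u v huv hT h => ?_⟩
  · change σ (c (t a)) = _
    rcases hcases j a with rfl | rfl | rfl
    · rw [hσ0, if_neg (e02 a)]
    · rw [← heq, hσ0, if_neg (e01 j)]
    · rw [hσ1, if_pos rfl]
  · refine hval u v huv (fun h => hT ?_) (σ.injective h)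
    rcases Sym2.eq_iff.1 h with ⟨rfl, rfl⟩ | ⟨rfl, rfl⟩
    exacts [⟨⟨_, rfl⟩, _, rfl⟩, ⟨⟨_, rfl⟩, _, rfl⟩]

theorem crown_deleteEdges_colorable (ht : ∀ i, G.Adj (t i) (t (i + 1))) (h3 : ¬ G.Colorable 3)
    (hcr : ∀ u v, G.Adj u v → (G.deleteEdges {s(u, v)}).Colorable 3) {a b : CrownVertex V}
    (hab : (G.crown t).Adj a b) : ((G.crown t).deleteEdges {s(a, b)}).Colorable 3 := by
  rcases crown_adj_iff.1 hab with ⟨u, v, huv, hT, rfl, rfl⟩ | ⟨w, w', hww, rfl, rfl⟩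
  · obtain ⟨c⟩ := hcr u v huv
    -- For a deleted old edge, the coloring of G without it pulls back: gadget edges fold onto
    -- triangle edges, so no other edge of the crowning folds onto the deleted one.
    refine ⟨Coloring.mk (fun a => c (crownFold t a)) @fun a b hab' => ?_⟩
    obtain ⟨hab', hne⟩ := deleteEdges_adj.1 hab'
    refine c.valid (deleteEdges_adj.2 ⟨adj_crownFold ht hab', fun h => ?_⟩)
    rcases crown_adj_iff.1 hab' with ⟨u', v', huv', -, rfl, rfl⟩ | ⟨x, x', hxx, rfl, rfl⟩
    · exact hne (by simpa [crownFold] using h)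
    · rw [crownFold_ofGadget, crownFold_ofGadget] at h
      rcases Sym2.eq_iff.1 h with ⟨rfl, rfl⟩ | ⟨rfl, rfl⟩
      exacts [hT ⟨⟨_, rfl⟩, _, rfl⟩, hT ⟨⟨_, rfl⟩, _, rfl⟩]
  -- For a deleted gadget edge, the gadget coloring dictates which two corners agree; deleting the
  -- triangle edge between these in G gives a coloring that can be glued to it.
  · obtain ⟨j, g, hg, hval⟩ := exists_gadget_coloring hww
    obtain ⟨c, hc, hval'⟩ := exists_coloring_deleteEdges ht h3 j (hcr _ _ (ht j))
    have hcg : ∀ x, Sum.elim c (fun r => g (.inr r)) (ofGadget t x) = g x := by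
      rintro (i | r)
      · simp [hc, hg]
      · rfl
    refine ⟨Coloring.mk (Sum.elim c fun r => g (.inr r)) @fun a b hab' => ?_⟩
    obtain ⟨hab', hne⟩ := deleteEdges_adj.1 hab'
    rcases crown_adj_iff.1 hab' with ⟨u', v', huv', hT, rfl, rfl⟩ | ⟨x, x', hxx, rfl, rfl⟩
    · exact hval' u' v' huv' hT
    · rw [hcg, hcg]
      refine hval x x' hxx fun h => hne ?_
      simpa using congrArg (Sym2.map (ofGadget t)) h

theorem encard_gadget_neighborSet (w : CrownVertex (Fin 3)) :
    (gadget.neighborSet w).encard = if w.isLeft then 2 else 4 := by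
  have h : ∀ w, (Finset.univ.filter (gadget.Adj w)).card = if w.isLeft then 2 else 4 := by
    decide +kernel
  have h2 : gadget.neighborSet w = (Finset.univ.filter (gadget.Adj w) : Finset _) := by
    ext; simp
  rw [h2, Set.encard_coe_eq_coe_finsetCard, h]
  split <;> rfl

/-- A corner exchanges its two triangle neighbors for two gadget neighbors; other old vertices keep
their neighbors, and new vertices have degree 4 in the gadget. -/
theorem crown_encard_neighborSet (ht : ∀ i, G.Adj (t i) (t (i + 1)))
    (hdeg : ∀ v, (G.neighborSet v).encard = 4) (a : CrownVertex V) :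
    ((G.crown t).neighborSet a).encard = 4 := by
  have hinj := injective_of_adj_succ ht
  have hg : Function.Injective (ofGadget t) := Sum.map_injective.2 ⟨hinj, Function.injective_id⟩
  have hinl : ∀ u w, Sum.inl u = ofGadget t w ↔ ∃ i, u = t i ∧ w = .inl i := by
    rintro u (i | r) <;> simp
  have hinr : ∀ r w, Sum.inr r = ofGadget t w ↔ w = .inr r := by
    rintro r (i | r') <;> simp [eq_comm]
  have hright : ∀ i w, gadget.Adj (.inl i) w → ∃ r, w = .inr r := by
    rintro i (j | r) h
    · exact absurd h (by revert i j; decide +kernel)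
    · exact ⟨r, rfl⟩
  rcases a with u | r
  · by_cases hu : ∃ i, u = t i
    · obtain ⟨i, rfl⟩ := hu
      have hset : (G.crown t).neighborSet (.inl (t i)) =
          Sum.inl '' (G.neighborSet (t i) \ {t (i + 1), t (i + 2)}) ∪
            ofGadget t '' gadget.neighborSet (.inl i) := by
        ext b
        rw [mem_neighborSet, crown_adj_iff, Set.mem_union]
        simp only [Set.mem_image, mem_neighborSet]
        refine or_congr ⟨?_, ?_⟩ ⟨?_, ?_⟩
        · rintro ⟨u, v, huv, hT, hu, rfl⟩
          obtain rfl := Sum.inl_injective hu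
          refine ⟨v, ⟨huv, ?_⟩, rfl⟩
          rintro (rfl | rfl)
          exacts [hT ⟨⟨_, rfl⟩, _, rfl⟩, hT ⟨⟨_, rfl⟩, _, rfl⟩]
        · rintro ⟨v, ⟨hv, hvT⟩, rfl⟩
          refine ⟨_, v, hv, ?_, rfl, rfl⟩
          rintro ⟨-, j, rfl⟩
          have hcases : ∀ j a : Fin 3, a = j ∨ a = j + 1 ∨ a = j + 2 := by decide
          rcases hcases i j with rfl | rfl | rfl
          · exact G.loopless.irrefl _ hv
          · exact hvT (Or.inl rfl)
          · exact hvT (Or.inr rfl)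
        · rintro ⟨w, w', hww, hw, rfl⟩
          obtain ⟨j, hj, rfl⟩ := (hinl _ _).1 hw
          obtain rfl := hinj hj
          exact ⟨w', hww, rfl⟩
        · rintro ⟨w', hww, rfl⟩
          exact ⟨_, w', hww, rfl, rfl⟩
      have e01 : ∀ j : Fin 3, j + 1 ≠ j + 2 := by decide
      have e02 : ∀ j : Fin 3, j ≠ j + 2 := by decide
      have hsub : ({t (i + 1), t (i + 2)} : Set V) ⊆ G.neighborSet (t i) := by
        rintro v (rfl | rfl)
        exacts [ht i, adj_of_adj_succ ht (e02 i)]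
      have hcard := Set.encard_sdiff_add_encard_of_subset hsub
      rw [hdeg, Set.encard_pair (hinj.ne (e01 i))] at hcard
      rw [hset, Set.encard_union_eq, Sum.inl_injective.encard_image, hg.encard_image,
        encard_gadget_neighborSet]
      · exact hcard
      · rw [Set.disjoint_left]
        rintro _ ⟨v, -, rfl⟩ ⟨w, hw, hwv⟩
        obtain ⟨r, rfl⟩ := hright i w hw
        simp at hwv
    · have hset : (G.crown t).neighborSet (.inl u) = Sum.inl '' G.neighborSet u := by
        ext b
        rw [mem_neighborSet, crown_adj_iff]
        simp only [Set.mem_image, mem_neighborSet]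
        constructor
        · rintro (⟨u', v, huv, -, hu', rfl⟩ | ⟨w, w', -, hw, -⟩)
          · obtain rfl := Sum.inl_injective hu'
            exact ⟨v, huv, rfl⟩
          · obtain ⟨i, hi, -⟩ := (hinl _ _).1 hw
            exact absurd ⟨i, hi⟩ hu
        · rintro ⟨v, hv, rfl⟩
          exact Or.inl ⟨u, v, hv, fun h => hu h.1, rfl, rfl⟩
      rw [hset, Sum.inl_injective.encard_image, hdeg]
  · have hset : (G.crown t).neighborSet (.inr r) = ofGadget t '' gadget.neighborSet (.inr r) := by
      ext b
      rw [mem_neighborSet, crown_adj_iff]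
      simp only [Set.mem_image, mem_neighborSet]
      constructor
      · rintro (⟨u', v, -, -, hu', -⟩ | ⟨w, w', hww, hw, rfl⟩)
        · simp at hu'
        · obtain rfl := (hinr _ _).1 hw
          exact ⟨w', hww, rfl⟩
      · rintro ⟨w', hw, rfl⟩
        exact Or.inr ⟨_, w', hw, rfl, rfl⟩
    rw [hset, hg.encard_image, encard_gadget_neighborSet]
    rfl

end SimpleGraph

namespace SimpleGraph

/-! ### The graph with 18 vertices -/

/-- Search for a `k`-coloring that extends the partial coloring `c` to the listed vertices; every
vertex comes with a list of neighbors whose colors it has to avoid. -/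
def searchColoring {V : Type*} [DecidableEq V] (k : ℕ) :
    List (V × List V) → (V → Option (Fin k)) → Bool
  | [], _ => true
  | (v, ns) :: l, c => (List.finRange k).any fun x =>
      ns.all (fun w => c w != some x) && searchColoring k l (Function.update c v (some x))

/-- The search can always follow an existing coloring f. Only this direction is needed: a failing
search refutes colorability. -/
theorem Coloring.searchColoring_eq_true {V : Type*} [DecidableEq V] {G : SimpleGraph V} {k : ℕ}
    (f : G.Coloring (Fin k)) (l : List (V × List V)) (hl : ∀ e ∈ l, ∀ w ∈ e.2, G.Adj e.1 w)
    (c : V → Option (Fin k)) (hc : ∀ w x, c w = some x → x = f w) :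
    searchColoring k l c = true := by
  induction l generalizing c with
  | nil => rfl
  | cons e l ih =>
    obtain ⟨v, ns⟩ := e
    simp only [searchColoring, List.any_eq_true, Bool.and_eq_true, List.all_eq_true, bne_iff_ne]
    refine ⟨f v, List.mem_finRange _, fun w hw hwv => ?_, ?_⟩
    · exact f.valid (hl _ List.mem_cons_self w hw) (hc w _ hwv)
    · refine ih (fun e he => hl e (List.mem_cons_of_mem _ he)) _ fun w x hx => ?_
      by_cases hwv : w = v
      · subst hwv
        simpa [eq_comm] using hx
      · exact hc w x (by simpa [hwv] using hx)

/-- The edges of the first graph of the sequence. -/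
def baseEdges : List (Fin 18 × Fin 18) :=
  [(0, 1), (0, 2), (0, 3), (0, 4), (1, 3), (1, 5), (1, 9), (2, 3), (2, 4), (2, 13), (3, 7),
    (4, 5), (4, 8), (5, 6), (5, 11), (6, 9), (6, 11), (6, 17), (7, 9), (7, 10), (7, 15), (8, 11),
    (8, 13), (8, 16), (9, 15), (10, 12), (10, 15), (10, 17), (11, 14), (12, 13), (12, 14),
    (12, 16), (13, 16), (14, 16), (14, 17), (15, 17)]

/-- The first graph of the sequence. -/
def baseGraph : SimpleGraph (Fin 18) := fromRel fun a b => (a, b) ∈ baseEdges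

/-- The triangle of `baseGraph` at which the first crowning takes place. -/
def baseTriangle : Fin 3 → Fin 18 := ![0, 1, 3]

/-- A straight-line drawing of `baseGraph`. -/
def basePt : Fin 18 → ℤ × ℤ :=
  ![(4, 0), (0, 4), (12, -4), (-4, -4), (8, 4), (4, 9), (2, 13), (-12, 12), (12, 11), (-4, 11),
    (-4, 27), (6, 13), (12, 27), (20, 12), (8, 19), (-5, 17), (13, 17), (0, 19)]

/-- A 2-fold coloring of `baseGraph` with 6 colors. -/
def baseFoldColoring : Fin 18 → Finset (Fin 6) :=
  ![{1, 5}, {0, 2}, {0, 2}, {3, 4}, {3, 4}, {1, 5}, {0, 4}, {1, 2}, {0, 1}, {3, 5}, {3, 5}, {2, 3},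
    {0, 1}, {4, 5}, {4, 5}, {0, 4}, {2, 3}, {1, 2}]

/-- Maps to three colors, one digit for each vertex, such that only one edge of `baseGraph` has two
ends of the same color. -/
def baseColorings : List ℕ :=
  [1221011222100021, 10210100222011120, 11020121002100122, 11202101220122100, 12110100222011120,
    11221011222100021, 11220200111022210, 12210100222011120, 11210212001200211,
    11220100222011120, 11220121002100122, 11222010221022011, 11220212001200211,
    11220010221022011, 11220101220122100, 11220200221022110, 11220100221022110,
    11220111002100221, 11220200011022210, 11220101202100122, 11220111002100122,
    11220211001122201, 11220210001200211, 11220210001122201, 11220210021022011,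
    11220210001022211, 11220111202100022, 11220101222100122, 11220100222022110,
    11220101222001120, 11220101222121100, 11220101222021100, 11220100222021120,
    11220100222021110, 11220101222100120, 11220111002100222]

/-- The color that the digits of `n` assign to a vertex. -/
def digitColoring (n : ℕ) (v : Fin 18) : Fin 3 := Fin.ofNat 3 (n / 10 ^ (17 - v.val) % 10)

instance : DecidableRel baseGraph.Adj := fun a b =>
  inferInstanceAs (Decidable (a ≠ b ∧ ((a, b) ∈ baseEdges ∨ (b, a) ∈ baseEdges)))

theorem baseGraph_adj {a b : Fin 18} (h : baseGraph.Adj a b) :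
    (a, b) ∈ baseEdges ∨ (b, a) ∈ baseEdges := h.2

theorem baseGraph_adj_triangle : ∀ i, baseGraph.Adj (baseTriangle i) (baseTriangle (i + 1)) := by
  decide +kernel

theorem baseGraph_encard_neighborSet (v : Fin 18) : (baseGraph.neighborSet v).encard = 4 := by
  have h : ∀ v, (Finset.univ.filter (baseGraph.Adj v)).card = 4 := by decide +kernel
  have h2 : baseGraph.neighborSet v = (Finset.univ.filter (baseGraph.Adj v) : Finset _) := by
    ext; simp
  rw [h2, Set.encard_coe_eq_coe_finsetCard, h]
  rfl

theorem baseGraph_not_colorable : ¬ baseGraph.Colorable 3 := by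
  rintro ⟨f⟩
  have h := f.searchColoring_eq_true
    -- Each edge of `baseEdges` has its smaller end first, so every vertex is tested against exactly
    -- its already colored neighbors.
    ((List.finRange 18).map fun v => (v, (baseEdges.filter (·.2 = v)).map (·.1)))
    (by decide +kernel) (fun _ => none) (by simp)
  revert h
  decide +kernel

/-- Vertex 0 is the digit at 10 ^ 17; digits missing on the left count as color 0. -/
theorem baseColorings_valid : ∀ e ∈ baseEdges, ∃ n ∈ baseColorings, ∀ f ∈ baseEdges,
    f = e ∨ digitColoring n f.1 ≠ digitColoring n f.2 := by
  decide +kernel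

theorem baseGraph_deleteEdges_colorable (u v : Fin 18) (huv : baseGraph.Adj u v) :
    (baseGraph.deleteEdges {s(u, v)}).Colorable 3 := by
  obtain ⟨e, he, hew⟩ : ∃ e ∈ baseEdges, s(u, v) = s(e.1, e.2) := by
    rcases baseGraph_adj huv with h | h
    exacts [⟨_, h, rfl⟩, ⟨_, h, Sym2.eq_swap⟩]
  obtain ⟨n, -, hn⟩ := baseColorings_valid e he
  refine ⟨Coloring.mk (digitColoring n) @fun a b hab => ?_⟩
  obtain ⟨hab, hne⟩ := deleteEdges_adj.1 hab
  rw [hew] at hne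
  rcases baseGraph_adj hab with h | h
  · exact (hn _ h).resolve_left fun h => hne (by rw [← h]; rfl)
  · exact ((hn _ h).resolve_left fun h => hne (by rw [← h, Sym2.eq_swap]; rfl)).symm

theorem baseGraph_isFoldColoring : baseGraph.IsFoldColoring 2 6 baseFoldColoring := by
  constructor <;> decide +kernel

theorem baseGraph_straightDrawing :
    ∃ p : Fin 18 → ℝ × ℝ, StraightDrawing 1 baseGraph baseTriangle p := by
  have h := StraightDrawing.of_lattice (M := 4) (P := basePt) (T := baseTriangle) baseEdges
    (fun _ _ => baseGraph_adj) (by decide +kernel) (by decide +kernel)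
    (by decide +kernel) (by decide +kernel) (by decide +kernel) (by decide +kernel)
  have h2 := h.smul (c := 1 / 4) (by norm_num)
  norm_num at h2
  exact ⟨_, h2⟩

/-! ### Fold colorings -/

/-- Each color is replaced by a block of b colors. Nonemptiness keeps the `sInf` in
`foldChromaticNumber` from being the default 0. -/
theorem Colorable.exists_isFoldColoring {V : Type*} {G : SimpleGraph V} {n : ℕ}
    (h : G.Colorable n) (b : ℕ) :
    {m : ℕ | ∃ c : V → Finset (Fin m), G.IsFoldColoring b m c}.Nonempty := by
  obtain ⟨f⟩ := h
  refine ⟨n * b, fun v => Finset.univ.map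
    ⟨fun j : Fin b => finProdFinEquiv (f v, j), fun i j hij => ?_⟩, fun v => by simp, ?_⟩
  · exact (Prod.ext_iff.1 (finProdFinEquiv.injective hij)).2
  · intro u v huv
    rw [Finset.disjoint_left]
    intro x hu hv
    simp only [Finset.mem_map, Finset.mem_univ, true_and] at hu hv
    obtain ⟨i, rfl⟩ := hu
    obtain ⟨j, hj⟩ := hv
    exact f.valid huv (Prod.ext_iff.1 (finProdFinEquiv.injective hj)).1.symm

/-- A triangle needs `3 * b` colors in a `b`-fold coloring. -/
theorem IsFoldColoring.three_mul_le {V : Type*} {G : SimpleGraph V} {b m : ℕ}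
    {c : V → Finset (Fin m)} (hc : G.IsFoldColoring b m c) {t : Fin 3 → V}
    (ht : ∀ i, G.Adj (t i) (t (i + 1))) : 3 * b ≤ m := by
  have hcard : (Finset.univ.biUnion fun i => c (t i)).card = ∑ i, (c (t i)).card :=
    Finset.card_biUnion fun i _ j _ hij => hc.2 _ _ (adj_of_adj_succ ht hij)
  have hle := (Finset.univ.biUnion fun i => c (t i)).card_le_univ
  simpa [hcard, hc.1] using hle

/-! ### The sequence -/

/-- The properties that are passed on from a graph to its crowning at the triangle `t`. -/
structure CrownSeed {V : Type*} (G : SimpleGraph V) (t : Fin 3 → V) : Prop where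
  adj_succ : ∀ i, G.Adj (t i) (t (i + 1))
  encard_neighborSet : ∀ v, (G.neighborSet v).encard = 4
  not_colorable : ¬ G.Colorable 3
  deleteEdges_colorable : ∀ u v, G.Adj u v → (G.deleteEdges {s(u, v)}).Colorable 3
  exists_isFoldColoring : ∃ c, G.IsFoldColoring 2 6 c
  exists_straightDrawing : ∃ p, StraightDrawing 1 G t p

theorem crownSeed_baseGraph : CrownSeed baseGraph baseTriangle where
  adj_succ := baseGraph_adj_triangle
  encard_neighborSet := baseGraph_encard_neighborSet
  not_colorable := baseGraph_not_colorable
  deleteEdges_colorable := baseGraph_deleteEdges_colorable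
  exists_isFoldColoring := ⟨_, baseGraph_isFoldColoring⟩
  exists_straightDrawing := baseGraph_straightDrawing

namespace CrownSeed

variable {V : Type*} {G : SimpleGraph V} {t : Fin 3 → V}

theorem crown (h : CrownSeed G t) : CrownSeed (G.crown t) (crownTriangle V) where
  adj_succ := crown_adj_triangle
  encard_neighborSet := crown_encard_neighborSet h.adj_succ h.encard_neighborSet
  not_colorable := fun hc => h.not_colorable hc.of_crown
  deleteEdges_colorable _ _ hab :=
    crown_deleteEdges_colorable h.adj_succ h.not_colorable h.deleteEdges_colorable hab
  exists_isFoldColoring := h.exists_isFoldColoring.imp' _ fun _ hc => hc.crown h.adj_succ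
  exists_straightDrawing := h.exists_straightDrawing.imp' _ fun _ => crown_straightDrawing

/-- Moves a crowning from its sum type of vertices to `Fin (18 + 9 * (k + 1))`. -/
theorem map_iso (h : CrownSeed G t) {W : Type*} {H : SimpleGraph W} (e : G ≃g H) :
    CrownSeed H (fun i => e (t i)) where
  adj_succ i := e.map_adj_iff.2 (h.adj_succ i)
  encard_neighborSet w := by
    rw [← h.encard_neighborSet (e.symm w), ← e.symm.injective.encard_image]
    congr 1
    ext v
    simp only [Set.mem_image, mem_neighborSet]
    constructor
    · rintro ⟨x, hx, rfl⟩
      exact e.symm.map_adj_iff.2 hx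
    · intro hv
      exact ⟨e v, by simpa using e.map_adj_iff.2 hv, by simp⟩
  not_colorable hc := h.not_colorable (hc.of_hom e.toHom)
  deleteEdges_colorable u v huv := by
    obtain ⟨c⟩ := h.deleteEdges_colorable _ _ (e.symm.map_adj_iff.2 huv)
    refine ⟨Coloring.mk (fun w => c (e.symm w)) @fun a b hab => ?_⟩
    obtain ⟨hab, hne⟩ := deleteEdges_adj.1 hab
    refine c.valid (deleteEdges_adj.2 ⟨e.symm.map_adj_iff.2 hab, fun heq => hne ?_⟩)
    simpa using congrArg (Sym2.map e) heq
  exists_isFoldColoring := by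
    obtain ⟨c, hc⟩ := h.exists_isFoldColoring
    exact ⟨fun w => c (e.symm w), fun _ => hc.1 _,
      fun _ _ huv => hc.2 _ _ (e.symm.map_adj_iff.2 huv)⟩
  exists_straightDrawing := h.exists_straightDrawing.imp' _ fun _ D => D.map_iso e

theorem isPlanar (h : CrownSeed G t) : G.IsPlanar :=
  let ⟨_, D⟩ := h.exists_straightDrawing
  ⟨D.toPlaneDrawing⟩

theorem isRegularOfDegree (h : CrownSeed G t) [G.LocallyFinite] : G.IsRegularOfDegree 4 := by
  intro v
  have := h.encard_neighborSet v
  rw [← coe_neighborFinset, Set.encard_coe_eq_coe_finsetCard, card_neighborFinset_eq_degree] at this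
  exact_mod_cast this

/-- Delete an edge at t 0, color with three colors, and give t 0 a fourth color of its own. -/
theorem colorable_four (h : CrownSeed G t) : G.Colorable 4 := by
  classical
  obtain ⟨c⟩ := h.deleteEdges_colorable _ _ (h.adj_succ 0)
  refine ⟨Coloring.mk (fun v => if v = t 0 then Fin.last 3 else (c v).castSucc)
    @fun u v huv => ?_⟩
  by_cases hu : u = t 0 <;> by_cases hv : v = t 0
  · exact absurd (hu.trans hv.symm) (G.ne_of_adj huv)
  · rw [if_pos hu, if_neg hv]
    exact (Fin.castSucc_lt_last _).ne'
  · rw [if_neg hu, if_pos hv]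
    exact (Fin.castSucc_lt_last _).ne
  · rw [if_neg hu, if_neg hv]
    refine fun heq => c.valid (deleteEdges_adj.2 ⟨huv, fun h => ?_⟩) (Fin.castSucc_injective _ heq)
    rcases Sym2.eq_iff.1 h with ⟨h, -⟩ | ⟨-, h⟩
    exacts [hu h, hv h]

theorem chromaticNumber_eq (h : CrownSeed G t) : G.chromaticNumber = 4 :=
  chromaticNumber_eq_iff_colorable_not_colorable.2 ⟨h.colorable_four, h.not_colorable⟩

theorem isEdgeCritical (h : CrownSeed G t) : G.IsEdgeCritical 4 := by
  refine ⟨h.chromaticNumber_eq, fun e he => ?_⟩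
  induction e using Sym2.ind with
  | _ u v =>
    rw [h.chromaticNumber_eq]
    refine (h.deleteEdges_colorable u v he).chromaticNumber_le.trans_lt ?_
    norm_num

theorem fractionalChromaticNumber_eq (h : CrownSeed G t) :
    G.fractionalChromaticNumber = 3 := by
  refine le_antisymm ?_ (le_ciInf fun b => ?_)
  · refine (ciInf_le ⟨0, ?_⟩ (2 : ℕ+)).trans ?_
    · rintro _ ⟨b, rfl⟩
      positivity
    · have h6 : G.foldChromaticNumber 2 ≤ 6 := Nat.sInf_le h.exists_isFoldColoring
      have h6' : (G.foldChromaticNumber 2 : ℝ) ≤ 6 := by exact_mod_cast h6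
      simp only [PNat.val_ofNat, Nat.cast_ofNat]
      linarith
  · rw [le_div_iff₀ (by exact_mod_cast b.pos)]
    -- The least number of colors is attained, so the triangle bound applies to an actual coloring.
    obtain ⟨c, hc⟩ := Nat.sInf_mem (h.colorable_four.exists_isFoldColoring (b : ℕ))
    exact_mod_cast hc.three_mul_le h.adj_succ

end CrownSeed

/-- The graphs of the sequence, each with the triangle for the next crowning. -/
def crownSequence : ∀ k : ℕ,
    {X : SimpleGraph (Fin (18 + 9 * k)) × (Fin 3 → Fin (18 + 9 * k)) // CrownSeed X.1 X.2}
  | 0 => ⟨(baseGraph, baseTriangle), crownSeed_baseGraph⟩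
  | k + 1 =>
    let X := crownSequence k
    let e : CrownVertex (Fin (18 + 9 * k)) ≃ Fin (18 + 9 * (k + 1)) :=
      Fintype.equivFinOfCardEq (by simp; ring)
    ⟨((X.1.1.crown X.1.2).map e.toEmbedding, fun i => e (crownTriangle _ i)),
      X.2.crown.map_iso (Iso.map e _)⟩

theorem crownSequence_succ (k : ℕ) : Nonempty ((crownSequence (k + 1)).1.1 ≃g
    (crownSequence k).1.1.crown (crownSequence k).1.2) :=
  ⟨(Iso.map _ _).symm⟩

end SimpleGraph

end

/-! ### The main theorem -/

theorem mainTheorem3 :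
    (∃ (G : ∀ k : ℕ, SimpleGraph (Fin (18 + 9 * k))) (_ : ∀ k, DecidableRel (G k).Adj),
      (∀ k, (G k).IsPlanar ∧ (G k).IsRegularOfDegree 4 ∧ (G k).IsEdgeCritical 4 ∧
        (G k).fractionalChromaticNumber = 3) ∧
      (∀ k, ∃ (D : PlaneDrawing (G k)) (t : Fin 3 → Fin (18 + 9 * k)),
        D.IsFacialTriangle t ∧ Nonempty (G (k + 1) ≃g (G k).crown t))) ∧
    ¬ (∀ (n : ℕ) (H : SimpleGraph (Fin n)), H.IsPlanar → H.chromaticNumber = 4 →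
        3 < H.fractionalChromaticNumber) := by
  classical
  refine ⟨⟨fun k => (SimpleGraph.crownSequence k).1.1, fun _ => inferInstance, fun k => ?_, fun k => ?_⟩,
    fun hall => ?_⟩
  · have h := (SimpleGraph.crownSequence k).2
    exact ⟨h.isPlanar, h.isRegularOfDegree, h.isEdgeCritical, h.fractionalChromaticNumber_eq⟩
  · have h := (SimpleGraph.crownSequence k).2
    obtain ⟨p, D⟩ := h.exists_straightDrawing
    exact ⟨D.toPlaneDrawing, _, D.isFacialTriangle h.adj_succ, SimpleGraph.crownSequence_succ k⟩
  -- The 18-vertex graph already refutes the conjecture.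
  · have h := SimpleGraph.crownSeed_baseGraph
    have := hall _ _ h.isPlanar h.chromaticNumber_eq
    rw [h.fractionalChromaticNumber_eq] at this
    exact this.false
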